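/- A topological space $X$ is called a Gruenhage space if there are families $(\mathscr{U}_n)_{n\in\mathbb{N}}$ of open subsets of $X$ such that for any distinct $x,y\in X$ there exist $n\in\mathbb{N}$ and $U\in\mathscr{U}_n$ for which (1) $U\cap\{x,y\}$ is a singleton, and (2) either $x$ lies in only finitely many members of $\mathscr{U}_n$ or $y$ lies in only finitely many members of $\mathscr{U}_n$. A Gruenhage compact is a compact Hausdorff space that is a Gruenhage space. Let $K$ be a Gruenhage compact, let $C(K)$ be the Banach space of continuous real-valued functions on $K$ with the supremum norm, and let $C(K)^*$ be its Banach dual. Then the closed unit ball $B_{C(K)^*}=\{\varphi\in C(K)^* : \|\varphi\|\le 1\}$ of the dual norm, with the relative $w^*$-topology, is also a Gruenhage compact. -/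

import Mathlib

/-- A topological space `X` is a Gruenhage space if there are countably many families `𝒰 n` of open
subsets of `X` such that for all distinct `x`, `y` there are `n` and `U ∈ 𝒰 n` for which
`U ∩ {x, y}` is a singleton, and `x` or `y` lies in only finitely many members of that `𝒰 n`. -/
def IsGruenhageSpace (X : Type*) [TopologicalSpace X] : Prop :=
  ∃ 𝒰 : ℕ → Set (Set X),
    (∀ n, ∀ U ∈ 𝒰 n, IsOpen U) ∧
    ∀ x y : X, x ≠ y → ∃ n, ∃ U ∈ 𝒰 n,
      (∃ z, U ∩ {x, y} = {z}) ∧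
      ({V | V ∈ 𝒰 n ∧ x ∈ V}.Finite ∨ {V | V ∈ 𝒰 n ∧ y ∈ V}.Finite)

/-- A Gruenhage compact: a compact Hausdorff space that is a Gruenhage space. -/
structure IsGruenhageCompact (X : Type*) [TopologicalSpace X] : Prop where
  compactSpace : CompactSpace X
  t2Space : T2Space X
  isGruenhageSpace : IsGruenhageSpace X

/-- The closed unit ball (for the dual norm) of the Banach dual of a real normed space `E`, as a
subset of that dual equipped with the weak-star topology. Its coercion to a type carries the
subspace topology, that is, the relative weak-star topology. -/
def dualUnitBall (E : Type*) [NormedAddCommGroup E] [NormedSpace ℝ E] : Set (WeakDual ℝ E) :=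
  {φ | ‖WeakDual.toStrongDual φ‖ ≤ 1}

open Set

theorem exists_inter_pair_eq_singleton_iff {α : Type*} {x y : α} (hne : x ≠ y) (U : Set α) :
    (∃ z, U ∩ {x, y} = {z}) ↔ ¬ (x ∈ U ↔ y ∈ U) := by
  constructor
  · rintro ⟨z, hz⟩ hiff
    have h := Set.ext_iff.1 hz
    have hzU := (h z).2 rfl
    have hxU : x ∈ U := by
      rcases hzU with ⟨hzU, rfl | rfl⟩
      · exact hzU
      · exact hiff.2 hzU
    exact hne (((h x).1 ⟨hxU, by simp⟩).trans ((h y).1 ⟨hiff.1 hxU, by simp⟩).symm)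
  · intro h
    by_cases hx : x ∈ U
    · refine ⟨x, inter_eq_right.2 (singleton_subset_iff.2 hx) ▸ ?_⟩
      ext w
      constructor
      · rintro ⟨hw, rfl | rfl⟩
        · exact ⟨hw, rfl⟩
        · exact absurd (iff_of_true hx hw) h
      · rintro ⟨hw, rfl⟩
        exact ⟨hw, by simp⟩
    · have hy : y ∈ U := by
        by_contra hy
        exact h (iff_of_false hx hy)
      refine ⟨y, ?_⟩
      ext w
      constructor
      · rintro ⟨hw, rfl | rfl⟩
        · exact absurd hw hx
        · rfl
      · rintro rfl
        exact ⟨hy, by simp⟩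

/-- A family of open sets which are pairwise disjoint modulo a common open subset, the base. -/
structure LayeredFamily (X : Type*) [TopologicalSpace X] where
  /-- The common open subset. -/
  base : Set X
  /-- The members of the family. -/
  sets : Set (Set X)
  isOpen_base : IsOpen base
  isOpen_of_mem : ∀ V ∈ sets, IsOpen V
  base_subset : ∀ V ∈ sets, base ⊆ V
  inter_subset : sets.Pairwise fun V W ↦ V ∩ W ⊆ base

namespace LayeredFamily

variable {X : Type*} [TopologicalSpace X] {ι : Type*}

/-- The layers of a layered family: its members with the base removed. -/
def layers (S : LayeredFamily X) : Set (Set X) := (· \ S.base) '' S.sets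

/-- A single open set, as a layered family with empty base. -/
def single (U : Set X) (hU : IsOpen U) : LayeredFamily X where
  base := ∅
  sets := {U}
  isOpen_base := isOpen_empty
  isOpen_of_mem := by simpa using hU
  base_subset := by simp
  inter_subset := by simp

@[simp]
theorem layers_single (U : Set X) (hU : IsOpen U) : (single U hU).layers = {U} := by
  simp [layers, single]

/-- The product of two layered families; its layers are the intersections of their layers. -/
def prod (S T : LayeredFamily X) : LayeredFamily X where
  base := S.base ∪ T.base
  sets := image2 (fun V W ↦ V ∩ W ∪ (S.base ∪ T.base)) S.sets T.sets
  isOpen_base := S.isOpen_base.union T.isOpen_base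
  isOpen_of_mem := by
    rintro _ ⟨V, hV, W, hW, rfl⟩
    exact ((S.isOpen_of_mem V hV).inter (T.isOpen_of_mem W hW)).union
      (S.isOpen_base.union T.isOpen_base)
  base_subset := by
    rintro _ ⟨V, hV, W, hW, rfl⟩
    exact subset_union_right
  inter_subset := by
    rintro _ ⟨V, hV, W, hW, rfl⟩ _ ⟨V', hV', W', hW', rfl⟩ hne x ⟨hx, hx'⟩
    by_contra hxb
    have h1 : x ∈ V ∩ W := hx.resolve_right hxb
    have h2 : x ∈ V' ∩ W' := hx'.resolve_right hxb
    have hVV : V = V' := by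
      by_contra h
      exact hxb (Or.inl (S.inter_subset hV hV' h ⟨h1.1, h2.1⟩))
    have hWW : W = W' := by
      by_contra h
      exact hxb (Or.inr (T.inter_subset hW hW' h ⟨h1.2, h2.2⟩))
    exact hne (by rw [hVV, hWW])

theorem layers_prod (S T : LayeredFamily X) :
    (S.prod T).layers = image2 (· ∩ ·) S.layers T.layers := by
  have key : ∀ V W : Set X, (V ∩ W ∪ (S.base ∪ T.base)) \ (S.base ∪ T.base) =
      (V \ S.base) ∩ (W \ T.base) := by
    intro V W
    ext x
    simp only [mem_sdiff, mem_union, mem_inter_iff]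
    tauto
  ext E
  simp only [layers, prod, mem_image, mem_image2]
  constructor
  · rintro ⟨_, ⟨V, hV, W, hW, rfl⟩, rfl⟩
    exact ⟨_, ⟨V, hV, rfl⟩, _, ⟨W, hW, rfl⟩, (key V W).symm⟩
  · rintro ⟨_, ⟨V, hV, rfl⟩, _, ⟨W, hW, rfl⟩, rfl⟩
    exact ⟨_, ⟨V, hV, W, hW, rfl⟩, key V W⟩

/-- The product of finitely many members of a collection of layered families. -/
def listProd (S : ι → LayeredFamily X) : List ι → LayeredFamily X
  | [] => single univ isOpen_univ
  | i :: l => (S i).prod (listProd S l)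

theorem inter_mem_layers_listProd (S : ι → LayeredFamily X) (l l' : List ι) {E F : Set X}
    (hE : E ∈ (listProd S l).layers) (hF : F ∈ (listProd S l').layers) :
    E ∩ F ∈ (listProd S (l ++ l')).layers := by
  induction l generalizing E with
  | nil =>
    have : E = univ := by simpa [listProd] using hE
    simpa [this] using hF
  | cons i l ih =>
    rw [listProd, layers_prod] at hE
    obtain ⟨D, hD, E', hE', rfl⟩ := hE
    rw [List.cons_append, listProd, layers_prod]
    exact ⟨D, hD, E' ∩ F, ih hE', (inter_assoc _ _ _).symm⟩

theorem isPiSystem_iUnion_layers_listProd (S : ι → LayeredFamily X) :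
    IsPiSystem (⋃ l, (listProd S l).layers) := by
  intro E hE F hF _
  obtain ⟨l, hl⟩ := mem_iUnion.1 hE
  obtain ⟨l', hl'⟩ := mem_iUnion.1 hF
  exact mem_iUnion.2 ⟨_, inter_mem_layers_listProd S l l' hl hl'⟩

theorem layers_subset_layers_listProd (S : ι → LayeredFamily X) (i : ι) :
    (S i).layers ⊆ (listProd S [i]).layers := by
  intro E hE
  rw [listProd, layers_prod]
  exact ⟨E, hE, univ, by simp [listProd], inter_univ E⟩

theorem pairwise_disjoint_sdiff (S : LayeredFamily X) :
    S.sets.Pairwise fun V W ↦ Disjoint (V \ S.base) (W \ S.base) := by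
  intro V hV W hW hne
  rw [Set.disjoint_left]
  exact fun x hx hx' ↦ hx.2 (S.inter_subset hV hW hne ⟨hx.1, hx'.1⟩)

theorem isOpen_setOf_lt_encard {𝒰 : Set (Set X)} (h𝒰 : ∀ U ∈ 𝒰, IsOpen U) (m : ℕ) :
    IsOpen {x | (m : ℕ∞) < {V | V ∈ 𝒰 ∧ x ∈ V}.encard} := by
  rw [isOpen_iff_forall_mem_open]
  intro x hx
  obtain ⟨F, hF, hFm⟩ := exists_subset_encard_eq (k := (m : ℕ∞) + 1) (Order.add_one_le_of_lt hx)
  have hfin : F.Finite := finite_of_encard_eq_coe (k := m + 1) (by simpa using hFm)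
  refine ⟨⋂₀ F, fun y hy ↦ ?_, hfin.isOpen_sInter fun U hU ↦ h𝒰 U (hF hU).1,
    fun U hU ↦ (hF hU).2⟩
  have h1 : F ⊆ {V | V ∈ 𝒰 ∧ y ∈ V} := fun V hV ↦ ⟨(hF hV).1, hy V hV⟩
  refine lt_of_lt_of_le ?_ (encard_le_encard h1)
  rw [hFm]
  exact_mod_cast Nat.lt_succ_self m

/-- The layered family of the intersections of `m` members of a given family of open sets. Its base
is the set of the points which lie in more than `m` members. -/
def ofFamily (𝒰 : Set (Set X)) (h𝒰 : ∀ U ∈ 𝒰, IsOpen U) (m : ℕ) : LayeredFamily X where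
  base := {x | (m : ℕ∞) < {V | V ∈ 𝒰 ∧ x ∈ V}.encard}
  sets := {W | ∃ F ⊆ 𝒰, F.encard = m ∧
    W = ⋂₀ F ∪ {x | (m : ℕ∞) < {V | V ∈ 𝒰 ∧ x ∈ V}.encard}}
  isOpen_base := isOpen_setOf_lt_encard h𝒰 m
  isOpen_of_mem := by
    rintro _ ⟨F, hF, hFm, rfl⟩
    exact ((finite_of_encard_eq_coe hFm).isOpen_sInter fun U hU ↦ h𝒰 U (hF hU)).union
      (isOpen_setOf_lt_encard h𝒰 m)
  base_subset := by
    rintro _ ⟨F, hF, hFm, rfl⟩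
    exact subset_union_right
  inter_subset := by
    rintro _ ⟨F, hF, hFm, rfl⟩ _ ⟨G, hG, hGm, rfl⟩ hne x ⟨hx, hx'⟩
    by_contra hxb
    have h1 : x ∈ ⋂₀ F := hx.resolve_right hxb
    have h2 : x ∈ ⋂₀ G := hx'.resolve_right hxb
    have hFG : F ≠ G := fun h ↦ hne (by rw [h])
    have hss : F ⊂ F ∪ G := by
      refine subset_union_left.ssubset_of_ne fun h ↦ hFG ?_
      have hGF : G ⊆ F := by rw [h]; exact subset_union_right
      exact ((finite_of_encard_eq_coe hGm).eq_of_subset_of_encard_le hGF (by rw [hFm, hGm])).symm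
    have hfin : (F ∪ G).Finite := (finite_of_encard_eq_coe hFm).union (finite_of_encard_eq_coe hGm)
    have hsub : F ∪ G ⊆ {V | V ∈ 𝒰 ∧ x ∈ V} :=
      union_subset (fun V hV ↦ ⟨hF hV, h1 V hV⟩) fun V hV ↦ ⟨hG hV, h2 V hV⟩
    refine hxb (lt_of_lt_of_le ?_ (encard_le_encard hsub))
    rw [← hFm]
    exact (finite_of_encard_eq_coe hFm).encard_lt_encard hss

theorem exists_separating_layer (𝒰 : Set (Set X)) (h𝒰 : ∀ U ∈ 𝒰, IsOpen U) {x y : X} {U : Set X}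
    (hU : U ∈ 𝒰) (hxy : ¬ (x ∈ U ↔ y ∈ U))
    (hx : {V | V ∈ 𝒰 ∧ x ∈ V}.Finite)
    (hle : {V | V ∈ 𝒰 ∧ x ∈ V}.encard ≤ {V | V ∈ 𝒰 ∧ y ∈ V}.encard) :
    ∃ m, (¬ (x ∈ (ofFamily 𝒰 h𝒰 m).base ↔ y ∈ (ofFamily 𝒰 h𝒰 m).base)) ∨
      ∃ E ∈ (ofFamily 𝒰 h𝒰 m).layers, ¬ (x ∈ E ↔ y ∈ E) := by
  obtain ⟨m, hm⟩ := hx.exists_encard_eq_coe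
  refine ⟨m, ?_⟩
  rcases hle.lt_or_eq with hlt | heq
  · left
    intro h
    have : y ∈ (ofFamily 𝒰 h𝒰 m).base := by
      change (m : ℕ∞) < _
      rwa [← hm]
    exact (show (m : ℕ∞) < _ from h.2 this).ne' hm
  · right
    refine ⟨_, ⟨_, ⟨{V | V ∈ 𝒰 ∧ x ∈ V}, fun V hV ↦ hV.1, hm, rfl⟩, rfl⟩, fun h ↦ ?_⟩
    have hyE := h.1 ⟨Or.inl fun V hV ↦ hV.2, fun h : (m : ℕ∞) < _ ↦ h.ne' hm⟩
    have hyF : y ∈ ⋂₀ {V | V ∈ 𝒰 ∧ x ∈ V} := hyE.1.resolve_right hyE.2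
    have hsub : {V | V ∈ 𝒰 ∧ x ∈ V} ⊆ {V | V ∈ 𝒰 ∧ y ∈ V} := fun V hV ↦ ⟨hV.1, hyF V hV⟩
    have heqs := hx.eq_of_subset_of_encard_le hsub heq.ge
    have hiff : x ∈ U ↔ y ∈ U := by
      have := Set.ext_iff.1 heqs U
      simpa [hU] using this
    exact hxy hiff

end LayeredFamily

open LayeredFamily in
/-- A Gruenhage space has countably many layered families whose layers separate points. -/
theorem IsGruenhageSpace.exists_layeredFamily {X : Type*} [TopologicalSpace X]
    (hX : IsGruenhageSpace X) :
    ∃ S : (ℕ × ℕ) ⊕ (ℕ × ℕ) → LayeredFamily X,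
      ∀ x y, x ≠ y → ∃ i, ∃ E ∈ (S i).layers, ¬ (x ∈ E ↔ y ∈ E) := by
  obtain ⟨𝒰, hopen, hsep⟩ := hX
  let S : (ℕ × ℕ) ⊕ (ℕ × ℕ) → LayeredFamily X := Sum.elim
    (fun p ↦ ofFamily (𝒰 p.1) (hopen p.1) p.2)
    (fun p ↦ single _ (ofFamily (𝒰 p.1) (hopen p.1) p.2).isOpen_base)
  have key : ∀ n x y, ∀ U ∈ 𝒰 n, ¬ (x ∈ U ↔ y ∈ U) →
      {V | V ∈ 𝒰 n ∧ x ∈ V}.Finite →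
      {V | V ∈ 𝒰 n ∧ x ∈ V}.encard ≤ {V | V ∈ 𝒰 n ∧ y ∈ V}.encard →
      ∃ i, ∃ E ∈ (S i).layers, ¬ (x ∈ E ↔ y ∈ E) := by
    intro n x y U hU hz hfin hle
    obtain ⟨m, h | h⟩ := exists_separating_layer (𝒰 n) (hopen n) hU hz hfin hle
    · exact ⟨Sum.inr (n, m), _, by simp only [S, Sum.elim_inr, layers_single]; rfl, h⟩
    · exact ⟨Sum.inl (n, m), h⟩
  refine ⟨S, fun x y hne ↦ ?_⟩
  obtain ⟨n, U, hU, hz, hfin⟩ := hsep x y hne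
  rw [exists_inter_pair_eq_singleton_iff hne] at hz
  rcases le_total {V | V ∈ 𝒰 n ∧ x ∈ V}.encard {V | V ∈ 𝒰 n ∧ y ∈ V}.encard with hle | hle
  · refine key n x y U hU hz ?_ hle
    rcases hfin with h | h
    · exact h
    · exact encard_lt_top_iff.1 (hle.trans_lt h.encard_lt_top)
  · obtain ⟨i, E, hE, h⟩ := key n y x U hU (fun h ↦ hz h.symm) (by
      rcases hfin with h | h
      · exact encard_lt_top_iff.1 (hle.trans_lt h.encard_lt_top)
      · exact h) hle
    exact ⟨i, E, hE, fun h' ↦ h h'.symm⟩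

section MeasureUniqueness
open MeasureTheory

/-- If a sequence of measurable sets separates the points outside a null set, then every closed set
agrees up to a null set with a member of the σ-algebra which the sequence generates. -/
theorem exists_measurableSet_generateFrom_ae_eq {K : Type*} [TopologicalSpace K] [CompactSpace K]
    [T2Space K] [MeasurableSpace K] [BorelSpace K] (μ : Measure K) [IsFiniteMeasure μ] [μ.Regular]
    (E : ℕ → Set K) (hE : ∀ n, MeasurableSet (E n)) (N : Set K) (hN : μ N = 0)
    (hsep : ∀ x ∉ N, ∀ y ∉ N, (∀ n, x ∈ E n ↔ y ∈ E n) → x = y) (A : Set K) (hA : IsClosed A) :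
    ∃ B, MeasurableSet[MeasurableSpace.generateFrom (range E)] B ∧ A =ᵐ[μ] B := by
  classical
  have lusin : ∀ ε : ENNReal, ε ≠ 0 → ∃ L : Set K, IsClosed L ∧ μ Lᶜ < ε ∧ Disjoint L N ∧
      ∀ n, ∃ O F, IsOpen O ∧ IsClosed F ∧ L ∩ O ⊆ E n ∧ L ∩ E n ⊆ O ∧ L ∩ F ⊆ E n ∧ L ∩ E n ⊆ F := by
    intro ε hε
    obtain ⟨δ, hδ, hδs⟩ := ENNReal.exists_pos_sum_of_countable' (ENNReal.half_pos hε).ne' ℕ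
    obtain ⟨G, hNG, hG, hGμ⟩ := N.exists_isOpen_lt_of_lt (μ := μ) (ε / 2)
      (by rw [hN]; exact ENNReal.half_pos hε)
    have hO : ∀ n, ∃ O ⊇ E n, IsOpen O ∧ μ O < ⊤ ∧ μ (O \ E n) < δ n / 2 := fun n ↦
      (hE n).exists_isOpen_sdiff_lt (measure_ne_top _ _) (ENNReal.half_pos (hδ n).ne').ne'
    have hF : ∀ n, ∃ F ⊆ E n, IsCompact F ∧ μ (E n \ F) < δ n / 2 := fun n ↦
      (hE n).exists_isCompact_sdiff_lt (measure_ne_top _ _) (ENNReal.half_pos (hδ n).ne').ne'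
    choose O hEO hO _ hOμ using hO
    choose F hFE hF hFμ using hF
    refine ⟨(G ∪ ⋃ n, (O n \ F n))ᶜ, ?_, ?_, ?_, fun n ↦ ⟨O n, F n, hO n, (hF n).isClosed, ?_⟩⟩
    · exact (hG.union (isOpen_iUnion fun n ↦ (hO n).sdiff (hF n).isClosed)).isClosed_compl
    · rw [compl_compl]
      have h1 : ∀ n, μ (O n \ F n) ≤ δ n := fun n ↦ by
        calc μ (O n \ F n) ≤ μ ((O n \ E n) ∪ (E n \ F n)) := measure_mono fun x hx ↦ by
              by_cases h : x ∈ E n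
              · exact Or.inr ⟨h, hx.2⟩
              · exact Or.inl ⟨hx.1, h⟩
          _ ≤ δ n / 2 + δ n / 2 := (measure_union_le _ _).trans (add_le_add (hOμ n).le (hFμ n).le)
          _ = δ n := ENNReal.add_halves _
      calc μ (G ∪ ⋃ n, (O n \ F n)) ≤ μ G + ∑' n, μ (O n \ F n) :=
            (measure_union_le _ _).trans (add_le_add le_rfl (measure_iUnion_le _))
        _ ≤ μ G + ∑' n, δ n := add_le_add le_rfl (ENNReal.tsum_le_tsum h1)
        _ < ε / 2 + ε / 2 := ENNReal.add_lt_add hGμ hδs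
        _ = ε := ENNReal.add_halves _
    · exact Set.disjoint_left.2 fun x hx hxN ↦ hx (Or.inl (hNG hxN))
    · have h : ∀ x ∈ (G ∪ ⋃ n, (O n \ F n))ᶜ, x ∈ O n → x ∈ F n := by
        intro x hx hxO
        by_contra hxF
        exact hx (Or.inr (mem_iUnion.2 ⟨n, hxO, hxF⟩))
      exact ⟨fun x hx ↦ hFE n (h x hx.1 hx.2), fun x hx ↦ hEO n hx.2, fun x hx ↦ hFE n hx.2,
        fun x hx ↦ h x hx.1 (hEO n hx.2)⟩
  have hpos : ∀ k : ℕ, ((k : ENNReal) + 1)⁻¹ ≠ 0 := fun k ↦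
    ENNReal.inv_ne_zero.2 (ENNReal.add_ne_top.2 ⟨ENNReal.natCast_ne_top k, ENNReal.one_ne_top⟩)
  choose L hLc hLμ hLN hL using fun k : ℕ ↦ lusin _ (hpos k)
  let g : K → ℕ → Bool := fun x n ↦ decide (x ∈ E n)
  have hg : ∀ k, ContinuousOn g (L k) := by
    intro k
    rw [continuousOn_pi]
    intro n
    obtain ⟨O, F, hO, hF, h1, h2, h3, h4⟩ := hL k n
    intro x hx
    by_cases hxE : x ∈ E n
    · have : (fun y ↦ g y n) =ᶠ[nhdsWithin x (L k)] fun _ ↦ true := by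
        filter_upwards [self_mem_nhdsWithin, nhdsWithin_le_nhds (hO.mem_nhds (h2 ⟨hx, hxE⟩))]
          with y hy hyO
        simpa [g] using h1 ⟨hy, hyO⟩
      exact continuousWithinAt_const.congr_of_eventuallyEq this (by simpa [g] using hxE)
    · have hxF : x ∈ Fᶜ := fun h ↦ hxE (h3 ⟨hx, h⟩)
      have : (fun y ↦ g y n) =ᶠ[nhdsWithin x (L k)] fun _ ↦ false := by
        filter_upwards [self_mem_nhdsWithin, nhdsWithin_le_nhds (hF.isOpen_compl.mem_nhds hxF)]
          with y hy hyF
        simpa [g] using fun h ↦ hyF (h4 ⟨hy, h⟩)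
      exact continuousWithinAt_const.congr_of_eventuallyEq this (by simpa [g] using hxE)
  have hgm : Measurable[MeasurableSpace.generateFrom (range E)] g := by
    refine @measurable_pi_lambda _ _ _ (MeasurableSpace.generateFrom (range E)) _ _ fun n ↦ ?_
    refine @measurable_to_bool _ (MeasurableSpace.generateFrom (range E)) _ ?_
    have : (fun x ↦ g x n) ⁻¹' {true} = E n := by ext x; simp [g]
    rw [this]
    exact MeasurableSpace.measurableSet_generateFrom (mem_range_self n)
  refine ⟨⋃ k, g ⁻¹' (g '' (A ∩ L k)), ?_, ?_⟩
  · refine @MeasurableSet.iUnion _ _ (MeasurableSpace.generateFrom (range E)) _ _ fun k ↦ hgm ?_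
    exact ((hA.inter (hLc k)).isCompact.image_of_continuousOn
      ((hg k).mono inter_subset_right)).measurableSet
  · have hnull : μ (⋂ k, (L k)ᶜ) = 0 := by
      by_contra h
      obtain ⟨k, hk⟩ := ENNReal.exists_inv_nat_lt h
      refine absurd (measure_mono (μ := μ) (iInter_subset (fun k ↦ (L k)ᶜ) k)) (not_le.2 ?_)
      refine (hLμ k).trans_le (le_trans ?_ hk.le)
      exact ENNReal.inv_le_inv.2 le_self_add
    have hae : ∀ᵐ x ∂μ, x ∉ ⋂ k, (L k)ᶜ := measure_eq_zero_iff_ae_notMem.1 hnull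
    filter_upwards [hae] with x hx
    simp only [mem_iInter, not_forall, mem_compl_iff, not_not] at hx
    obtain ⟨j, hj⟩ := hx
    refine propext ⟨fun hxA ↦ mem_iUnion.2 ⟨j, x, ⟨hxA, hj⟩, rfl⟩, fun h ↦ ?_⟩
    obtain ⟨k, y, ⟨hyA, hyL⟩, hyx⟩ := mem_iUnion.1 h
    have : y = x := hsep y (Set.disjoint_left.1 (hLN k) hyL) x (Set.disjoint_left.1 (hLN j) hj)
      fun n ↦ by simpa [g] using congrFun hyx n
    exact this ▸ hyA

namespace LayeredFamily

variable {K : Type*} [TopologicalSpace K] [MeasurableSpace K] [BorelSpace K]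

theorem measurableSet_of_mem_layers (S : LayeredFamily K) {E : Set K} (hE : E ∈ S.layers) :
    MeasurableSet E := by
  obtain ⟨V, hV, rfl⟩ := hE
  exact (S.isOpen_of_mem V hV).measurableSet.diff S.isOpen_base.measurableSet

theorem measure_sUnion_null_layers (S : LayeredFamily K) (μ : Measure K) [IsFiniteMeasure μ]
    [μ.Regular] : μ (⋃₀ {E ∈ S.layers | μ E = 0}) = 0 := by
  have heq : ⋃₀ {E ∈ S.layers | μ E = 0} =
      (⋃ V : {V : Set K // V ∈ S.sets ∧ μ (V \ S.base) = 0}, V.1) \ S.base := by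
    ext x
    simp only [layers, mem_sUnion, mem_sdiff, mem_iUnion]
    constructor
    · rintro ⟨_, ⟨⟨V, hV, rfl⟩, h0⟩, hx⟩
      exact ⟨⟨⟨V, hV, h0⟩, hx.1⟩, hx.2⟩
    · rintro ⟨⟨V, hx⟩, hxb⟩
      exact ⟨_, ⟨⟨V, V.2.1, rfl⟩, V.2.2⟩, hx, hxb⟩
  have hopen : ∀ V : {V : Set K // V ∈ S.sets ∧ μ (V \ S.base) = 0}, IsOpen V.1 :=
    fun V ↦ S.isOpen_of_mem V.1 V.2.1
  rw [heq, ((isOpen_iUnion hopen).measurableSet.diff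
    S.isOpen_base.measurableSet).measure_eq_iSup_isCompact_of_ne_top (measure_ne_top _ _)]
  simp only [ENNReal.iSup_eq_zero]
  intro L hL hLc
  obtain ⟨t, ht⟩ := hLc.elim_finite_subcover _ hopen (hL.trans sdiff_subset)
  refine measure_mono_null (t := ⋃ V ∈ t, V.1 \ S.base) (fun x hx ↦ ?_) ?_
  · obtain ⟨V, hV, hxV⟩ := mem_iUnion₂.1 (ht hx)
    exact mem_iUnion₂.2 ⟨V, hV, hxV, (hL hx).2⟩
  · exact (measure_biUnion_null_iff t.countable_toSet).2 fun V _ ↦ V.2.2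

theorem countable_layers_measure_ne_zero (S : LayeredFamily K) (μ : Measure K)
    [IsFiniteMeasure μ] : {E ∈ S.layers | μ E ≠ 0}.Countable := by
  have h := Measure.countable_meas_pos_of_disjoint_iUnion (μ := μ)
    (As := fun V : S.sets ↦ V.1 \ S.base)
    (fun V ↦ S.measurableSet_of_mem_layers ⟨V.1, V.2, rfl⟩)
    (fun V W hne ↦ S.pairwise_disjoint_sdiff V.2 W.2 (fun h ↦ hne (Subtype.ext h)))
  refine (h.image fun V : S.sets ↦ V.1 \ S.base).mono ?_
  rintro _ ⟨⟨V, hV, rfl⟩, h0⟩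
  exact ⟨⟨V, hV⟩, pos_iff_ne_zero.2 h0, rfl⟩

theorem finite_lt_measure (S : LayeredFamily K) (μ : Measure K) [IsFiniteMeasure μ]
    {q : ENNReal} (hq : μ S.base < q) : {V ∈ S.sets | q < μ V}.Finite := by
  have h := Measure.finite_const_le_meas_of_disjoint_iUnion μ (tsub_pos_of_lt hq)
    (As := fun V : S.sets ↦ V.1 \ S.base)
    (fun V ↦ S.measurableSet_of_mem_layers ⟨V.1, V.2, rfl⟩)
    (fun V W hne ↦ S.pairwise_disjoint_sdiff V.2 W.2 (fun h ↦ hne (Subtype.ext h)))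
    (measure_ne_top _ _)
  refine (h.image Subtype.val).subset ?_
  rintro V ⟨hV, hqV⟩
  exact ⟨⟨V, hV⟩, (tsub_le_tsub_right hqV.le _).trans le_measure_sdiff, rfl⟩

/-- Finite regular measures which agree on the finite intersections of the layers of countably many
layered families are equal, provided that these layers separate points. -/
theorem measure_ext [CompactSpace K] [T2Space K] {ι : Type*} [Countable ι]
    (S : ι → LayeredFamily K)
    (hS : ∀ x y, x ≠ y → ∃ i, ∃ E ∈ (S i).layers, ¬ (x ∈ E ↔ y ∈ E))
    (μ ν : Measure K) [IsFiniteMeasure μ] [IsFiniteMeasure ν] [μ.Regular] [ν.Regular]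
    (h : ∀ l, ∀ E ∈ (listProd S l).layers, μ E = ν E) : μ = ν := by
  have huniv : μ univ = ν univ := h [] univ (by simp [listProd])
  let C : Set (Set K) := insert univ (⋃ i, {E ∈ (S i).layers | (μ + ν) E ≠ 0})
  have hC : C.Countable :=
    (countable_iUnion fun i ↦ (S i).countable_layers_measure_ne_zero (μ + ν)).insert _
  obtain ⟨E, hE⟩ := hC.exists_eq_range ⟨univ, mem_insert _ _⟩
  let N : Set K := ⋃ i, ⋃₀ {E ∈ (S i).layers | (μ + ν) E = 0}
  have hN : (μ + ν) N = 0 :=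
    measure_iUnion_null fun i ↦ (S i).measure_sUnion_null_layers (μ + ν)
  have hmem : ∀ n, E n ∈ ⋃ l, (listProd S l).layers := by
    intro n
    have : E n ∈ C := hE ▸ mem_range_self n
    rcases this with h | h
    · rw [h]
      exact mem_iUnion.2 ⟨[], by simp [listProd]⟩
    · obtain ⟨i, hi⟩ := mem_iUnion.1 h
      exact mem_iUnion.2 ⟨[i], layers_subset_layers_listProd S i hi.1⟩
  have hmeas : ∀ F ∈ ⋃ l, (listProd S l).layers, MeasurableSet F := fun F hF ↦ by
    obtain ⟨l, hl⟩ := mem_iUnion.1 hF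
    exact (listProd S l).measurableSet_of_mem_layers hl
  have hsep : ∀ x ∉ N, ∀ y ∉ N, (∀ n, x ∈ E n ↔ y ∈ E n) → x = y := by
    intro x hx y hy hxy
    by_contra hne
    obtain ⟨i, F, hF, hxyF⟩ := hS x y hne
    by_cases h0 : (μ + ν) F = 0
    · have hFN : F ⊆ N := fun z hz ↦ mem_iUnion.2 ⟨i, F, ⟨hF, h0⟩, hz⟩
      exact hxyF ⟨fun h ↦ absurd (hFN h) hx, fun h ↦ absurd (hFN h) hy⟩
    · have : F ∈ C := Or.inr (mem_iUnion.2 ⟨i, hF, h0⟩)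
      rw [hE] at this
      obtain ⟨n, rfl⟩ := this
      exact hxyF (hxy n)
  have hle : MeasurableSpace.generateFrom (⋃ l, (listProd S l).layers) ≤
      ‹MeasurableSpace K› := MeasurableSpace.generateFrom_le hmeas
  have htrim : ∀ B, MeasurableSet[MeasurableSpace.generateFrom (⋃ l, (listProd S l).layers)] B →
      μ B = ν B := by
    intro B hB
    have : μ.trim hle = ν.trim hle := by
      refine ext_of_generate_finite (m0 := .generateFrom (⋃ l, (listProd S l).layers)) _ rfl
        (isPiSystem_iUnion_layers_listProd S) (fun F hF ↦ ?_) ?_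
      · have hFm := MeasurableSpace.measurableSet_generateFrom hF
        rw [trim_measurableSet_eq hle hFm, trim_measurableSet_eq hle hFm]
        obtain ⟨l, hl⟩ := mem_iUnion.1 hF
        exact h l F hl
      · rwa [trim_measurableSet_eq hle MeasurableSet.univ,
          trim_measurableSet_eq hle MeasurableSet.univ]
    rw [← trim_measurableSet_eq hle hB, ← trim_measurableSet_eq hle hB, this]
  refine ext_of_generate_finite _ ?_ isPiSystem_isClosed (fun A hA ↦ ?_) huniv
  · rw [BorelSpace.measurable_eq (α := K), borel_eq_generateFrom_isClosed]
  · obtain ⟨B, hB, hAB⟩ := exists_measurableSet_generateFrom_ae_eq (μ + ν) E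
      (fun n ↦ hmeas _ (hmem n)) N hN hsep A hA
    have hB' : MeasurableSet[MeasurableSpace.generateFrom (⋃ l, (listProd S l).layers)] B :=
      MeasurableSpace.generateFrom_mono (range_subset_iff.2 hmem) B hB
    rw [ae_eq_set] at hAB
    have hAB' : μ (A \ B) = 0 ∧ ν (A \ B) = 0 ∧ μ (B \ A) = 0 ∧ ν (B \ A) = 0 := by
      simpa [and_assoc] using hAB
    rw [measure_congr (μ := μ) (ae_eq_set.2 ⟨hAB'.1, hAB'.2.2.1⟩),
      measure_congr (μ := ν) (ae_eq_set.2 ⟨hAB'.2.1, hAB'.2.2.2⟩), htrim B hB']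

end LayeredFamily

end MeasureUniqueness

section PositivePart
open MeasureTheory CompactlySupported
open scoped NNReal

variable {K : Type*} [TopologicalSpace K]

namespace WeakDual

/-- The values of a functional on the order interval from `0` to `f`. -/
def intervalValues (φ : WeakDual ℝ C(K, ℝ)) (f : C(K, ℝ)) : Set ℝ :=
  {r | ∃ g : C(K, ℝ), 0 ≤ g ∧ g ≤ f ∧ φ g = r}

/-- The positive part of a functional, as a function on the nonnegative continuous functions. -/
noncomputable def posPartFun (φ : WeakDual ℝ C(K, ℝ)) (f : C(K, ℝ)) : ℝ :=
  sSup (intervalValues φ f)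

variable (φ : WeakDual ℝ C(K, ℝ)) {f g : C(K, ℝ)}

theorem posPartFun_le (hf : 0 ≤ f) {r : ℝ} (h : ∀ g, 0 ≤ g → g ≤ f → φ g ≤ r) :
    posPartFun φ f ≤ r := by
  refine csSup_le ⟨_, 0, le_rfl, hf, rfl⟩ ?_
  rintro _ ⟨g, hg, hgf, rfl⟩
  exact h g hg hgf

theorem exists_lt_of_lt_posPartFun (hf : 0 ≤ f) {r : ℝ} (h : r < posPartFun φ f) :
    ∃ g, 0 ≤ g ∧ g ≤ f ∧ r < φ g := by
  by_contra! hcon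
  exact h.not_ge (posPartFun_le φ hf hcon)

theorem toContinuousMap_toReal_nonneg (f : C_c(K, ℝ≥0)) : (0 : C(K, ℝ)) ≤ f.toReal.toContinuousMap :=
  fun x ↦ by
    change 0 ≤ f.toReal x
    simp

variable [CompactSpace K]

theorem bddAbove_intervalValues (f : C(K, ℝ)) : BddAbove (intervalValues φ f) := by
  refine ⟨‖WeakDual.toStrongDual φ‖ * ‖f‖, ?_⟩
  rintro _ ⟨g, hg0, hgf, rfl⟩
  have h1 : ‖g‖ ≤ ‖f‖ := by
    refine (ContinuousMap.norm_le _ (norm_nonneg _)).2 fun x ↦ ?_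
    have h0 : 0 ≤ g x := hg0 x
    have h2 : g x ≤ f x := hgf x
    rw [Real.norm_of_nonneg h0]
    exact h2.trans ((le_abs_self _).trans (f.norm_coe_le_norm x))
  calc φ g ≤ ‖WeakDual.toStrongDual φ g‖ := le_abs_self _
    _ ≤ ‖WeakDual.toStrongDual φ‖ * ‖g‖ := ContinuousLinearMap.le_opNorm _ _
    _ ≤ _ := by gcongr

theorem le_posPartFun (hg : 0 ≤ g) (hgf : g ≤ f) : φ g ≤ posPartFun φ f :=
  le_csSup (bddAbove_intervalValues φ f) ⟨g, hg, hgf, rfl⟩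

theorem posPartFun_nonneg (hf : 0 ≤ f) : 0 ≤ posPartFun φ f := by
  simpa using le_posPartFun φ le_rfl hf

theorem posPartFun_add {f₁ f₂ : C(K, ℝ)} (h₁ : 0 ≤ f₁) (h₂ : 0 ≤ f₂) :
    posPartFun φ (f₁ + f₂) = posPartFun φ f₁ + posPartFun φ f₂ := by
  apply le_antisymm
  · refine posPartFun_le φ (add_nonneg h₁ h₂) fun g hg hgf ↦ ?_
    have hsplit : φ g = φ (g ⊓ f₁) + φ (g - g ⊓ f₁) := by rw [← map_add]; simp
    rw [hsplit]
    refine add_le_add (le_posPartFun φ (le_inf hg h₁) inf_le_right)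
      (le_posPartFun φ (sub_nonneg.2 inf_le_left) fun x ↦ ?_)
    have h2 : g x ≤ f₁ x + f₂ x := hgf x
    have h3 : 0 ≤ f₂ x := h₂ x
    change g x - min (g x) (f₁ x) ≤ f₂ x
    rcases min_cases (g x) (f₁ x) with h | h <;> linarith
  · rw [← le_sub_iff_add_le]
    refine posPartFun_le φ h₁ fun g₁ hg₁ hgf₁ ↦ ?_
    rw [le_sub_comm]
    refine posPartFun_le φ h₂ fun g₂ hg₂ hgf₂ ↦ ?_
    rw [le_sub_iff_add_le', ← map_add]
    exact le_posPartFun φ (add_nonneg hg₁ hg₂) (add_le_add hgf₁ hgf₂)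

theorem smul_posPartFun_le (hf : 0 ≤ f) {c : ℝ} (hc : 0 < c) :
    c * posPartFun φ f ≤ posPartFun φ (c • f) := by
  rw [← le_div_iff₀' hc]
  refine posPartFun_le φ hf fun g hg hgf ↦ ?_
  rw [le_div_iff₀' hc, ← smul_eq_mul, ← map_smul]
  exact le_posPartFun φ (smul_nonneg hc.le hg) (smul_le_smul_of_nonneg_left hgf hc.le)

theorem posPartFun_smul (hf : 0 ≤ f) {c : ℝ} (hc : 0 ≤ c) :
    posPartFun φ (c • f) = c * posPartFun φ f := by
  rcases hc.eq_or_lt with rfl | hc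
  · rw [zero_smul, zero_mul]
    refine le_antisymm (posPartFun_le φ le_rfl fun g hg hg' ↦ ?_) (posPartFun_nonneg φ le_rfl)
    rw [le_antisymm hg' hg, map_zero]
  · refine le_antisymm ?_ (smul_posPartFun_le φ hf hc)
    have := smul_posPartFun_le φ (smul_nonneg hc.le hf) (inv_pos.2 hc)
    rwa [inv_smul_smul₀ hc.ne', inv_mul_le_iff₀ hc] at this

theorem posPartFun_sub_posPartFun_neg (hf : 0 ≤ f) :
    posPartFun φ f - posPartFun (-φ) f = φ f := by
  have key : ∀ ψ : WeakDual ℝ C(K, ℝ), posPartFun ψ f ≤ posPartFun (-ψ) f + ψ f := by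
    intro ψ
    refine posPartFun_le ψ hf fun g hg hgf ↦ ?_
    have h := le_posPartFun (-ψ) (sub_nonneg.2 hgf) (sub_le_self f hg)
    have h' : (-ψ) (f - g) = ψ g - ψ f := by
      change -(ψ (f - g)) = _
      rw [map_sub]; ring
    linarith
  have h1 := key φ
  have h2 := key (-φ)
  rw [neg_neg] at h2
  have h3 : (-φ) f = -φ f := rfl
  linarith

/-- The positive part of a functional on `C(K, ℝ)`. -/
noncomputable def posPartLinear : C_c(K, ℝ≥0) →ₗ[ℝ≥0] ℝ≥0 where
  toFun f := ⟨posPartFun φ f.toReal.toContinuousMap, posPartFun_nonneg φ (toContinuousMap_toReal_nonneg f)⟩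
  map_add' f g := NNReal.eq <| by
    have h : (f + g).toReal.toContinuousMap = f.toReal.toContinuousMap + g.toReal.toContinuousMap := by
      ext x; simp
    change posPartFun φ (f + g).toReal.toContinuousMap = _
    rw [h]
    exact posPartFun_add φ (toContinuousMap_toReal_nonneg f) (toContinuousMap_toReal_nonneg g)
  map_smul' c f := NNReal.eq <| by
    have h : (c • f).toReal.toContinuousMap = (c : ℝ) • f.toReal.toContinuousMap := by
      ext x; simp [NNReal.smul_def]
    change posPartFun φ (c • f).toReal.toContinuousMap = _
    rw [h]
    exact posPartFun_smul φ (toContinuousMap_toReal_nonneg f) c.2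

theorem coe_posPartLinear (f : C_c(K, ℝ≥0)) :
    (posPartLinear φ f : ℝ) = posPartFun φ f.toReal.toContinuousMap := rfl

variable [T2Space K] [MeasurableSpace K] [BorelSpace K]

/-- The regular measure which represents the positive part of a functional on `C(K, ℝ)`. -/
noncomputable def posMeasure : Measure K := NNRealRMK.rieszMeasure (posPartLinear φ)

instance : (posMeasure φ).Regular := NNRealRMK.rieszMeasure_regular _

theorem lintegral_posMeasure (f : C_c(K, ℝ≥0)) :
    ∫⁻ x, f x ∂(posMeasure φ) = posPartLinear φ f := NNRealRMK.lintegral_rieszMeasure _ f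

theorem ext_of_posMeasure {φ ψ : WeakDual ℝ C(K, ℝ)} (h : posMeasure φ = posMeasure ψ)
    (h' : posMeasure (-φ) = posMeasure (-ψ)) : φ = ψ := by
  have hlin : ∀ {φ ψ : WeakDual ℝ C(K, ℝ)}, posMeasure φ = posMeasure ψ →
      ∀ f : C_c(K, ℝ≥0), posPartFun φ f.toReal.toContinuousMap =
        posPartFun ψ f.toReal.toContinuousMap := by
    intro φ ψ h f
    have := lintegral_posMeasure φ f
    rw [h, lintegral_posMeasure, ENNReal.coe_inj] at this
    rw [← coe_posPartLinear, ← coe_posPartLinear, this]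
  have hnonneg : ∀ f : C_c(K, ℝ≥0), φ f.toReal.toContinuousMap = ψ f.toReal.toContinuousMap := by
    intro f
    rw [← posPartFun_sub_posPartFun_neg φ (toContinuousMap_toReal_nonneg f),
      ← posPartFun_sub_posPartFun_neg ψ (toContinuousMap_toReal_nonneg f), hlin h, hlin h']
  refine ContinuousLinearMap.ext fun f ↦ ?_
  let F : C_c(K, ℝ) := ⟨f, HasCompactSupport.of_compactSpace f⟩
  have hF : f = F.nnrealPart.toReal.toContinuousMap - (-F).nnrealPart.toReal.toContinuousMap := by
    have := congrArg (fun G : C_c(K, ℝ) ↦ G.toContinuousMap)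
      (CompactlySupportedContinuousMap.nnrealPart_sub_nnrealPart_neg F)
    exact this.symm
  rw [hF]
  change φ _ = ψ _
  rw [map_sub, map_sub, hnonneg, hnonneg]

theorem isOpen_setOf_lt_posMeasure {U : Set K} (hU : IsOpen U) (q : ℝ≥0) :
    IsOpen {φ : WeakDual ℝ C(K, ℝ) | (q : ENNReal) < posMeasure φ U} := by
  rw [isOpen_iff_forall_mem_open]
  intro φ hφ
  obtain ⟨L, hLU, hL, hqL⟩ := hU.exists_lt_isCompact (μ := posMeasure φ) hφ
  obtain ⟨f₀, hf1, hf0, -, hf01⟩ := exists_continuous_one_zero_of_isCompact hL hU.isClosed_compl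
    (disjoint_compl_right_iff_subset.2 hLU)
  let f : C_c(K, ℝ≥0) :=
    CompactlySupportedContinuousMap.nnrealPart ⟨f₀, HasCompactSupport.of_compactSpace f₀⟩
  have hf : ∀ x, f x = (f₀ x).toNNReal := fun x ↦ rfl
  have hfL : posMeasure φ L ≤ posPartLinear φ f := by
    rw [← lintegral_posMeasure, ← lintegral_indicator_one hL.measurableSet]
    refine lintegral_mono fun x ↦ ?_
    by_cases hx : x ∈ L
    · simp [hx, hf, hf1 hx]
    · simp [hx]
  have hfU : ∀ ψ, (posPartLinear ψ f : ENNReal) ≤ posMeasure ψ U := by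
    intro ψ
    rw [← lintegral_posMeasure, ← lintegral_indicator_one hU.measurableSet]
    refine lintegral_mono fun x ↦ ?_
    by_cases hx : x ∈ U
    · simpa [hx, hf] using (hf01 x).2
    · simp [hx, hf, hf0 hx]
  have hq : (q : ℝ) < posPartFun φ f.toReal.toContinuousMap := by
    rw [← coe_posPartLinear]
    exact_mod_cast hqL.trans_le hfL
  obtain ⟨g, hg, hgf, hqg⟩ := exists_lt_of_lt_posPartFun φ (toContinuousMap_toReal_nonneg f) hq
  refine ⟨{ψ | (q : ℝ) < ψ g}, fun ψ hψ ↦ ?_, isOpen_lt continuous_const (WeakDual.eval_continuous g),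
    hqg⟩
  refine lt_of_lt_of_le ?_ (hfU ψ)
  have : (q : ℝ) < posPartLinear ψ f := lt_of_lt_of_le hψ (le_posPartFun ψ hg hgf)
  exact_mod_cast this

end WeakDual

end PositivePart

section Gruenhage

variable {X Y : Type*} [TopologicalSpace X] [TopologicalSpace Y]

theorem IsGruenhageSpace.of_countable {ι : Type*} [Countable ι] (𝒰 : ι → Set (Set X))
    (hopen : ∀ i, ∀ U ∈ 𝒰 i, IsOpen U)
    (hsep : ∀ x y : X, x ≠ y → ∃ i, ∃ U ∈ 𝒰 i, ¬ (x ∈ U ↔ y ∈ U) ∧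
      ({V | V ∈ 𝒰 i ∧ x ∈ V}.Finite ∨ {V | V ∈ 𝒰 i ∧ y ∈ V}.Finite)) :
    IsGruenhageSpace X := by
  obtain ⟨e, he⟩ := exists_injective_nat ι
  refine ⟨fun n ↦ {U | ∃ i, e i = n ∧ U ∈ 𝒰 i}, ?_, fun x y hne ↦ ?_⟩
  · rintro _ U ⟨i, rfl, hU⟩
    exact hopen i U hU
  · obtain ⟨i, U, hU, hxy, hfin⟩ := hsep x y hne
    have hi : {U | ∃ j, e j = e i ∧ U ∈ 𝒰 j} = 𝒰 i := by
      ext V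
      constructor
      · rintro ⟨j, hj, hV⟩
        exact he hj ▸ hV
      · exact fun hV ↦ ⟨i, rfl, hV⟩
    refine ⟨e i, ?_⟩
    simp only [hi]
    exact ⟨U, hU, (exists_inter_pair_eq_singleton_iff hne U).2 hxy, hfin⟩

theorem IsGruenhageSpace.comap (hY : IsGruenhageSpace Y) {f : X → Y} (hf : Continuous f)
    (hinj : Function.Injective f) : IsGruenhageSpace X := by
  obtain ⟨𝒰, hopen, hsep⟩ := hY
  have hfin : ∀ n x, {V | V ∈ 𝒰 n ∧ f x ∈ V}.Finite →
      {W | W ∈ preimage f '' 𝒰 n ∧ x ∈ W}.Finite := by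
    refine fun n x h ↦ (h.image (preimage f)).subset ?_
    rintro _ ⟨⟨V, hV, rfl⟩, hx⟩
    exact ⟨V, ⟨hV, hx⟩, rfl⟩
  refine .of_countable (fun n ↦ preimage f '' 𝒰 n) ?_ fun x y hne ↦ ?_
  · rintro n _ ⟨U, hU, rfl⟩
    exact (hopen n U hU).preimage hf
  · obtain ⟨n, U, hU, hz, h⟩ := hsep (f x) (f y) (hinj.ne hne)
    exact ⟨n, _, ⟨U, hU, rfl⟩, (exists_inter_pair_eq_singleton_iff (hinj.ne hne) U).1 hz,
      h.imp (hfin n x) (hfin n y)⟩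

end Gruenhage

section Dual
open MeasureTheory LayeredFamily WeakDual
open scoped NNReal

variable {K : Type*} [TopologicalSpace K] [CompactSpace K] [T2Space K]

/-- The dual of `C(K, ℝ)` is a Gruenhage space in the weak-star topology if `K` is one. -/
theorem IsGruenhageSpace.weakDual (hK : IsGruenhageSpace K) :
    IsGruenhageSpace (WeakDual ℝ C(K, ℝ)) := by
  borelize K
  obtain ⟨S, hS⟩ := hK.exists_layeredFamily
  let T : List ((ℕ × ℕ) ⊕ (ℕ × ℕ)) ⊕ List ((ℕ × ℕ) ⊕ (ℕ × ℕ)) → LayeredFamily K :=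
    Sum.elim (listProd S) fun l ↦ single _ (listProd S l).isOpen_base
  let m : Bool → WeakDual ℝ C(K, ℝ) → Measure K := fun b φ ↦ posMeasure (if b then φ else -φ)
  let O : Bool → ℚ → Set K → Set (WeakDual ℝ C(K, ℝ)) := fun b q V ↦
    {φ | ((Real.toNNReal q : ℝ≥0) : ENNReal) < m b φ V}
  have hO : ∀ b q V, IsOpen V → IsOpen (O b q V) := by
    rintro (_ | _) q V hV
    · exact (isOpen_setOf_lt_posMeasure hV _).preimage continuous_neg
    · exact isOpen_setOf_lt_posMeasure hV _
  have key : ∀ b t, ∀ V ∈ (T t).sets, ∀ φ ψ, m b φ V < m b ψ V →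
      ∃ q, ψ ∈ O b q V ∧ φ ∉ O b q V ∧ {W | W ∈ O b q '' (T t).sets ∧ φ ∈ W}.Finite := by
    intro b t V hV φ ψ hlt
    obtain ⟨q, -, hq1, hq2⟩ := ENNReal.lt_iff_exists_rat_btwn.1 hlt
    have : IsFiniteMeasure (m b φ) := inferInstanceAs (IsFiniteMeasure (posMeasure _))
    refine ⟨q, hq2, not_lt.2 hq1.le, ?_⟩
    have hb : m b φ (T t).base < (Real.toNNReal q : ℝ≥0) :=
      (measure_mono ((T t).base_subset V hV)).trans_lt hq1
    refine (((T t).finite_lt_measure (m b φ) hb).image (O b q)).subset ?_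
    rintro _ ⟨⟨W, hW, rfl⟩, hφ⟩
    exact ⟨W, ⟨hW, hφ⟩, rfl⟩
  have hsep : ∀ φ ψ, φ ≠ ψ → ∃ b t, ∃ V ∈ (T t).sets, m b φ V ≠ m b ψ V := by
    intro φ ψ hne
    by_contra! hcon
    have hm : ∀ b, m b φ = m b ψ := by
      intro b
      refine measure_ext S hS (posMeasure _) (posMeasure _) ?_
      rintro l _ ⟨V, hV, rfl⟩
      have h1 := hcon b (Sum.inl l) V hV
      have h2 := hcon b (Sum.inr l) (listProd S l).base rfl
      have hsub := (listProd S l).base_subset V hV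
      have hmb := (listProd S l).isOpen_base.measurableSet
      change m b φ (V \ _) = m b ψ (V \ _)
      rw [measure_sdiff hsub hmb.nullMeasurableSet (measure_ne_top (posMeasure _) _),
        measure_sdiff hsub hmb.nullMeasurableSet (measure_ne_top (posMeasure _) _), h1, h2]
    exact hne (ext_of_posMeasure (hm true) (hm false))
  refine .of_countable (fun p : Bool × _ × ℚ ↦ O p.1 p.2.2 '' (T p.2.1).sets) ?_ fun φ ψ hne ↦ ?_
  · rintro ⟨b, t, q⟩ _ ⟨V, hV, rfl⟩
    exact hO b q V ((T t).isOpen_of_mem V hV)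
  · obtain ⟨b, t, V, hV, hVne⟩ := hsep φ ψ hne
    rcases hVne.lt_or_gt with hlt | hlt
    · obtain ⟨q, h1, h2, h3⟩ := key b t V hV φ ψ hlt
      exact ⟨(b, t, q), _, ⟨V, hV, rfl⟩, fun h ↦ h2 (h.2 h1), Or.inl h3⟩
    · obtain ⟨q, h1, h2, h3⟩ := key b t V hV ψ φ hlt
      exact ⟨(b, t, q), _, ⟨V, hV, rfl⟩, fun h ↦ h2 (h.1 h1), Or.inr h3⟩

end Dual

theorem isCompact_dualUnitBall (E : Type*) [NormedAddCommGroup E] [NormedSpace ℝ E] :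
    IsCompact (dualUnitBall E) := by
  have : dualUnitBall E = WeakDual.toStrongDual ⁻¹' Metric.closedBall 0 1 := by
    ext φ
    simp [dualUnitBall]
  rw [this]
  exact WeakDual.isCompact_closedBall 0 1

theorem proposition4p2 (K : Type*) [TopologicalSpace K] [CompactSpace K]
    (hK : IsGruenhageCompact K) :
    IsGruenhageCompact (dualUnitBall C(K, ℝ)) := by
  have := hK.t2Space
  exact ⟨isCompact_iff_compactSpace.1 (isCompact_dualUnitBall _), inferInstance,
    hK.isGruenhageSpace.weakDual.comap continuous_subtype_val Subtype.val_injective⟩
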